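/- Let $d\ge 2$ be an integer and $\alpha\in(0,1)$. For a measurable function $f$ on $\mathbb{R}^d$ with values in $[-\infty,\infty]$ let $f^*(t)=\inf\{y\ge 0:\ |\{|f|>y\}|<t\}$ ($t>0$) be its non-increasing rearrangement, let $f^{**}(t)=\frac1t\int_0^t f^*(s)\,ds$, and for $1<q<\infty$ let \[ \|f\|_{L^{q,1}(\mathbb{R}^d)}=\int_0^\infty t^{1/q}f^{**}(t)\,\frac{dt}{t}\in[0,\infty]. \] For $u\in L^1(\mathbb{R}^d)$ let \[ |Du|(\mathbb{R}^d)=\sup\Big\{\int_{\mathbb{R}^d}u\,\operatorname{div}\Phi\,dx:\ \Phi\in C^1_c(\mathbb{R}^d;\mathbb{R}^d),\ |\Phi|\le 1\Big\}, \] let $BV(\mathbb{R}^d)$ be the set of (real-valued) $u\in L^1(\mathbb{R}^d)$ with $|Du|(\mathbb{R}^d)<\infty$, and for $u\in BV(\mathbb{R}^d)$ let \[ \mathcal{D}^{1-\alpha}(u)(x)=\int_{\mathbb{R}^d}\frac{|u(x)-u(y)|}{|x-y|^{d+1-\alpha}}\,dy\in[0,\infty]. \] Then there exists a constant $C=C(\alpha,d)>0$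 such that for all $u\in BV(\mathbb{R}^d)$ \[ \|\mathcal{D}^{1-\alpha}(u)\|_{L^{d/(d-\alpha),1}(\mathbb{R}^d)}\le C\,\big(|Du|(\mathbb{R}^d)\big)^{1-\alpha}\,\|u\|_{L^{d/(d-1),1}(\mathbb{R}^d)}^{\alpha}. \] -/

import Mathlib

open MeasureTheory Set
open scoped ENNReal

noncomputable section

namespace LorentzBV

/-- The distribution function `m(f, y) = |{f > y}|` of a nonnegative extended-real function
(a signed function `u` enters through its modulus `‖u ·‖ₑ`). -/
def distribution {X : Type*} [MeasurableSpace X] (μ : Measure X) (f : X → ℝ≥0∞)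
    (y : ℝ≥0∞) : ℝ≥0∞ :=
  μ {x | y < f x}

/-- The nonincreasing rearrangement `f*`, the left-continuous generalized inverse of the
distribution function: `f*(t) = inf {y ≥ 0 : m(f, y) < t}` for `t > 0`. -/
def rearrangement {X : Type*} [MeasurableSpace X] (μ : Measure X) (f : X → ℝ≥0∞)
    (t : ℝ) : ℝ≥0∞ :=
  sInf {y | distribution μ f y < ENNReal.ofReal t}

/-- The averaged rearrangement `f**(t) = (1/t) ∫₀ᵗ f*(s) ds`, for `t > 0`. -/
def maximalRearrangement {X : Type*} [MeasurableSpace X] (μ : Measure X) (f : X → ℝ≥0∞)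
    (t : ℝ) : ℝ≥0∞ :=
  (∫⁻ s in Ioc 0 t, rearrangement μ f s) / ENNReal.ofReal t

/-- The Lorentz norm `‖f‖_{L^{q,r}} = (∫₀^∞ [t^{1/q} f**(t)]^r dt/t)^{1/r}`,
for `1 < q < ∞` and `1 ≤ r < ∞`. -/
def lorentzNorm {X : Type*} [MeasurableSpace X] (μ : Measure X) (q r : ℝ)
    (f : X → ℝ≥0∞) : ℝ≥0∞ :=
  (∫⁻ t in Ioi (0 : ℝ),
    (ENNReal.ofReal t ^ (1 / q) * maximalRearrangement μ f t) ^ r / ENNReal.ofReal t) ^ (1 / r)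

/-- The divergence `∑ᵢ ∂ᵢ Φᵢ` of a vector field on `ℝ^d`. -/
def divergence {d : ℕ} (Φ : EuclideanSpace ℝ (Fin d) → EuclideanSpace ℝ (Fin d))
    (x : EuclideanSpace ℝ (Fin d)) : ℝ :=
  ∑ i, fderiv ℝ Φ x (EuclideanSpace.single i 1) i

/-- The total variation `|Du|(ℝ^d)` of the distributional derivative of `u`: the supremum of
`∫ u div Φ` over `Φ ∈ C¹_c(ℝ^d; ℝ^d)` with `|Φ| ≤ 1` everywhere. -/
def totalVariation {d : ℕ} (u : EuclideanSpace ℝ (Fin d) → ℝ) : ℝ≥0∞ :=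
  ⨆ (Φ : EuclideanSpace ℝ (Fin d) → EuclideanSpace ℝ (Fin d)) (_ : ContDiff ℝ 1 Φ)
    (_ : HasCompactSupport Φ) (_ : ∀ x, ‖Φ x‖ ≤ 1),
    ENNReal.ofReal (∫ x, u x * divergence Φ x)

/-- `u ∈ BV(ℝ^d)`: `u` is integrable and `|Du|(ℝ^d)` is finite. -/
def IsBV {d : ℕ} (u : EuclideanSpace ℝ (Fin d) → ℝ) : Prop :=
  Integrable u ∧ totalVariation u < ∞

/-- The nonlinear fractional differential operator
`𝒟^s(u)(x) = ∫ |u(x) - u(y)| / |x - y|^{d+s} dy`, with values in `[0, ∞]`. -/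
def fracD {d : ℕ} (s : ℝ) (u : EuclideanSpace ℝ (Fin d) → ℝ)
    (x : EuclideanSpace ℝ (Fin d)) : ℝ≥0∞ :=
  ∫⁻ y, ‖u x - u y‖ₑ / ‖x - y‖ₑ ^ ((d : ℝ) + s)

end LorentzBV

/-!
`|u (x + h) - u x|` is the measure of the set of levels `τ` separating `u x` from `u (x + h)`. For a
fixed level `τ`, the measure `ψ h` of the set of `x` for which `τ` separates the two values is
subadditive in `h`, at most `2 m(τ)` with `m(τ) = |{|τ| ≤ |u|}|`, and at most `P(τ) |h|`, where
`∫ P ≤ C |Du|`. With the coarea formula `P(τ)` could be the perimeter of `{τ ≤ u}`; here it is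
obtained from the means of `ψ` over small balls, which control `ψ` by subadditivity. By Fatou's
lemma and `∫ |u (x + h) - u x| dx ≤ |h| |Du|`, its integral over `τ` is at most `C |Du|`.

The functional `∫₀ᵗ f*` is subadditive and bounded both by `‖f‖₁` and by `t ‖f‖_∞`. Applying
the better bound to each pair `(τ, h)` and integrating over `h` gives
`∫₀ᵗ (𝒟^{1-α} u)* ≤ C ∫ P(τ)^{1-α} min(t, m(τ))^α dτ`. Integrating against `t^{-α/d-1} dt` turns the
minimum into `m(τ)^{α(d-1)/d}`, and Hölder's inequality in `τ` separates `(∫ P)^{1-α}` from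
`(∫ m^{(d-1)/d})^α`, the latter being controlled by the Lorentz norm of `u`.
-/

namespace LorentzBV

open Filter Topology
open scoped Convolution

theorem setLIntegral_Ioo_rpow {a : ℝ} (ha : 0 < a) {r : ℝ} (hr : 0 < r) :
    ∫⁻ t in Ioo 0 r, ENNReal.ofReal t ^ (a - 1) = ENNReal.ofReal r ^ a / ENNReal.ofReal a := by
  have hint : IntegrableOn (fun t : ℝ => t ^ (a - 1)) (Ioo 0 r) :=
    (intervalIntegrable_iff_integrableOn_Ioo_of_le hr.le).1
      (intervalIntegral.intervalIntegrable_rpow' (by linarith))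
  calc ∫⁻ t in Ioo 0 r, ENNReal.ofReal t ^ (a - 1)
      = ∫⁻ t in Ioo 0 r, ENNReal.ofReal (t ^ (a - 1)) :=
        setLIntegral_congr_fun measurableSet_Ioo fun t ht => ENNReal.ofReal_rpow_of_pos ht.1
    _ = ENNReal.ofReal (∫ t in Ioo 0 r, t ^ (a - 1)) := by
        rw [ofReal_integral_eq_lintegral_ofReal hint]
        filter_upwards [ae_restrict_mem measurableSet_Ioo] with t ht
        exact Real.rpow_nonneg ht.1.le _
    _ = ENNReal.ofReal (r ^ a / a) := by
        rw [← integral_Ioc_eq_integral_Ioo, ← intervalIntegral.integral_of_le hr.le,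
          integral_rpow (Or.inl (by linarith)), sub_add_cancel, Real.zero_rpow ha.ne', sub_zero]
    _ = _ := by rw [ENNReal.ofReal_div_of_pos ha, ENNReal.ofReal_rpow_of_pos hr]

theorem setLIntegral_Ioi_rpow {a : ℝ} (ha : 0 < a) {r : ℝ} (hr : 0 < r) :
    ∫⁻ t in Ioi r, ENNReal.ofReal t ^ (-a - 1) = ENNReal.ofReal r ^ (-a) / ENNReal.ofReal a := by
  have hint : IntegrableOn (fun t : ℝ => t ^ (-a - 1)) (Ioi r) :=
    integrableOn_Ioi_rpow_of_lt (by linarith) hr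
  calc ∫⁻ t in Ioi r, ENNReal.ofReal t ^ (-a - 1)
      = ∫⁻ t in Ioi r, ENNReal.ofReal (t ^ (-a - 1)) :=
        setLIntegral_congr_fun measurableSet_Ioi fun t ht =>
          ENNReal.ofReal_rpow_of_pos (hr.trans ht)
    _ = ENNReal.ofReal (∫ t in Ioi r, t ^ (-a - 1)) := by
        rw [ofReal_integral_eq_lintegral_ofReal hint]
        filter_upwards [ae_restrict_mem measurableSet_Ioi] with t ht
        exact Real.rpow_nonneg (hr.trans ht).le _
    _ = ENNReal.ofReal (r ^ (-a) / a) := by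
        rw [integral_Ioi_rpow_of_lt (by linarith) hr, sub_add_cancel, neg_div_neg_eq]
    _ = _ := by rw [ENNReal.ofReal_div_of_pos ha, ENNReal.ofReal_rpow_of_pos hr]

theorem setLIntegral_ofReal_lt_rpow {a : ℝ} (ha : 0 < a) (r : ℝ≥0∞) :
    ∫⁻ t in {t : ℝ | 0 < t ∧ ENNReal.ofReal t < r}, ENNReal.ofReal t ^ (a - 1) =
      r ^ a / ENNReal.ofReal a := by
  rcases eq_or_ne r 0 with rfl | h0
  · simp [ENNReal.zero_rpow_of_pos ha]
  rcases eq_or_ne r ∞ with rfl | hr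
  · have hlim : Tendsto (fun n : ℕ => ((n + 1 : ℕ) : ℝ≥0∞) ^ a / ENNReal.ofReal a)
        atTop (𝓝 (∞ ^ a / ENNReal.ofReal a)) :=
      ENNReal.Tendsto.div_const
        ((ENNReal.continuous_rpow_const.tendsto _).comp
          (ENNReal.tendsto_nat_nhds_top.comp (tendsto_add_atTop_nat 1)))
        (Or.inl (by simp [ENNReal.top_rpow_of_pos ha]))
    rw [ENNReal.top_rpow_of_pos ha, ENNReal.top_div_of_ne_top ENNReal.ofReal_ne_top] at hlim ⊢
    refine eq_top_iff.2 (le_of_tendsto' hlim fun n => ?_)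
    rw [← ENNReal.ofReal_natCast, ← setLIntegral_Ioo_rpow ha (r := (n + 1 : ℕ)) (by positivity)]
    exact lintegral_mono_set fun t ht => ⟨ht.1, ENNReal.ofReal_lt_top⟩
  · have hset : {t : ℝ | 0 < t ∧ ENNReal.ofReal t < r} = Ioo 0 r.toReal := by
      ext t
      exact and_congr_right fun ht => ENNReal.ofReal_lt_iff_lt_toReal ht.le hr
    rw [hset, setLIntegral_Ioo_rpow ha (ENNReal.toReal_pos h0 hr), ENNReal.ofReal_toReal hr]

theorem mul_div_rpow {P : ℝ≥0∞} (hP0 : P ≠ 0) (hP : P ≠ ∞) (M : ℝ≥0∞) {s : ℝ} (hs : 0 ≤ s) :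
    P * (M / P) ^ s = P ^ (1 - s) * M ^ s := by
  have hPs : P = P ^ (1 - s) * P ^ s := by
    rw [← ENNReal.rpow_add _ _ hP0 hP, sub_add_cancel, ENNReal.rpow_one]
  rw [ENNReal.div_rpow_of_nonneg _ _ hs]
  nth_rewrite 1 [hPs]
  rw [mul_assoc, ENNReal.mul_div_cancel (by simp [ENNReal.rpow_eq_zero_iff, hP0, hP])
    (ENNReal.rpow_ne_top_of_nonneg hs hP)]

theorem exists_pos_ofReal_rpow_eq {γ : ℝ} (hγ : 0 < γ) {c : ℝ≥0∞} (h0 : c ≠ 0) (hc : c ≠ ∞) :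
    ∃ r : ℝ, 0 < r ∧ ENNReal.ofReal r ^ γ = c := by
  have h1 : c ^ (1 / γ) ≠ 0 := by simp [ENNReal.rpow_eq_zero_iff, h0, hγ.not_gt]
  have h2 : c ^ (1 / γ) ≠ ∞ := ENNReal.rpow_ne_top_of_nonneg (by positivity) hc
  refine ⟨(c ^ (1 / γ)).toReal, ENNReal.toReal_pos h1 h2, ?_⟩
  rw [ENNReal.ofReal_toReal h2, ← ENNReal.rpow_mul, one_div_mul_cancel hγ.ne', ENNReal.rpow_one]

theorem lintegral_rpow_mul_min_le_add {b γ : ℝ} (hb : 0 < b) (hbγ : b < γ) (P M : ℝ≥0∞) {r : ℝ}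
    (hr : 0 < r) :
    ∫⁻ t in Ioi (0 : ℝ), ENNReal.ofReal t ^ (-b - 1) * min (P * ENNReal.ofReal t ^ γ) M ≤
      P * (ENNReal.ofReal r ^ (γ - b) / ENNReal.ofReal (γ - b)) +
        M * (ENNReal.ofReal r ^ (-b) / ENNReal.ofReal b) := by
  rw [← setLIntegral_Ioo_rpow (sub_pos.2 hbγ) hr, ← setLIntegral_Ioi_rpow hb hr,
    setLIntegral_congr Ioo_ae_eq_Ioc, ← lintegral_const_mul _ (by fun_prop),
    ← lintegral_const_mul _ (by fun_prop), ← Ioc_union_Ioi_eq_Ioi hr.le]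
  refine (lintegral_union_le _ _ _).trans (add_le_add ?_ (lintegral_mono fun t => ?_))
  · refine setLIntegral_mono' measurableSet_Ioc fun t ht => ?_
    rw [show γ - b - 1 = (-b - 1) + γ by ring,
      ENNReal.rpow_add _ _ (by simpa using ht.1) ENNReal.ofReal_ne_top, mul_left_comm]
    gcongr
    exact min_le_left _ _
  · rw [mul_comm]
    gcongr
    exact min_le_right _ _

theorem lintegral_rpow_mul_min_le {b γ : ℝ} (hb : 0 < b) (hbγ : b < γ) (P M : ℝ≥0∞) :
    ∫⁻ t in Ioi (0 : ℝ), ENNReal.ofReal t ^ (-b - 1) * min (P * ENNReal.ofReal t ^ γ) M ≤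
      ((ENNReal.ofReal (γ - b))⁻¹ + (ENNReal.ofReal b)⁻¹) * (P ^ (b / γ) * M ^ (1 - b / γ)) := by
  have hγ : 0 < γ := hb.trans hbγ
  have hθ : 0 < b / γ := by positivity
  have hθ' : 0 < 1 - b / γ := sub_pos.2 ((div_lt_one hγ).2 hbγ)
  have hc : (ENNReal.ofReal (γ - b))⁻¹ + (ENNReal.ofReal b)⁻¹ ≠ 0 := by simp
  rcases eq_or_ne P 0 with rfl | hP0
  · simp
  rcases eq_or_ne M 0 with rfl | hM0
  · simp
  rcases eq_or_ne P ∞ with rfl | hP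
  · simp [ENNReal.top_rpow_of_pos hθ, ENNReal.rpow_eq_zero_iff, hM0, hθ'.not_gt, hc]
  rcases eq_or_ne M ∞ with rfl | hM
  · simp [ENNReal.top_rpow_of_pos hθ', ENNReal.rpow_eq_zero_iff, hP0, hP, hc]
  -- The two arguments of the minimum agree at `t = r`.
  obtain ⟨r, hr, hrγ⟩ := exists_pos_ofReal_rpow_eq hγ (c := M / P)
    (ENNReal.div_ne_zero.2 ⟨hM0, hP⟩) (ENNReal.div_ne_top hM hP0)
  have hpow (x : ℝ) : ENNReal.ofReal r ^ x = (M / P) ^ (x / γ) := by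
    rw [← hrγ, ← ENNReal.rpow_mul, mul_div_cancel₀ _ hγ.ne']
  have hnear : P * ENNReal.ofReal r ^ (γ - b) = P ^ (b / γ) * M ^ (1 - b / γ) := by
    rw [hpow, sub_div, div_self hγ.ne', mul_div_rpow hP0 hP _ hθ'.le, sub_sub_cancel]
  have hfar : M * ENNReal.ofReal r ^ (-b) = P ^ (b / γ) * M ^ (1 - b / γ) := by
    rw [hpow, neg_div, ENNReal.rpow_neg, ← ENNReal.inv_rpow,
      ENNReal.inv_div (Or.inl hP) (Or.inl hP0), mul_div_rpow hM0 hM _ hθ.le, mul_comm]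
  refine (lintegral_rpow_mul_min_le_add hb hbγ P M hr).trans_eq ?_
  rw [← mul_div_assoc, ← mul_div_assoc, hnear, hfar, ENNReal.div_eq_inv_mul,
    ENNReal.div_eq_inv_mul, add_mul]

section Polar

variable {E : Type*} [NormedAddCommGroup E] [NormedSpace ℝ E] [MeasurableSpace E]
  [BorelSpace E] [FiniteDimensional ℝ E] [Nontrivial E] (μ : Measure E) [μ.IsAddHaarMeasure]

theorem lintegral_fun_norm_addHaar {f : ℝ → ℝ≥0∞} (hf : Measurable f) :
    ∫⁻ x, f ‖x‖ ∂μ = μ.toSphere univ *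
      ∫⁻ y in Ioi (0 : ℝ), ENNReal.ofReal (y ^ (Module.finrank ℝ E - 1)) * f y := by
  have hzero : ∫⁻ x, f ‖x‖ ∂μ = ∫⁻ x : ({0}ᶜ : Set E), f ‖x.1‖ ∂μ.comap (↑) := by
    rw [lintegral_subtype_comap (measurableSet_singleton _).compl fun x => f ‖x‖,
      restrict_compl_singleton]
  calc ∫⁻ x, f ‖x‖ ∂μ
      = ∫⁻ x, f x.2 ∂μ.toSphere.prod (.volumeIoiPow (Module.finrank ℝ E - 1)) := by
        rw [hzero]
        simpa using μ.measurePreserving_homeomorphUnitSphereProd.lintegral_comp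
          (f := fun x => f x.2) (by fun_prop)
    _ = μ.toSphere univ * ∫⁻ x : Ioi (0 : ℝ), f x ∂.volumeIoiPow (Module.finrank ℝ E - 1) := by
        rw [lintegral_prod _ (by fun_prop)]
        simp only [lintegral_const, mul_comm]
    _ = _ := by
        rw [Measure.volumeIoiPow, lintegral_withDensity_eq_lintegral_mul _ (by fun_prop)
          (by fun_prop), ← lintegral_subtype_comap measurableSet_Ioi]
        rfl

theorem lintegral_min_mul_enorm_rpow_le {b γ : ℝ} (hb : 0 < b) (hbγ : b < γ) (P M : ℝ≥0∞) :
    ∫⁻ h : E, min (P * ‖h‖ₑ ^ γ) M * ‖h‖ₑ ^ (-b - Module.finrank ℝ E) ∂μ ≤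
      μ.toSphere univ * (((ENNReal.ofReal (γ - b))⁻¹ + (ENNReal.ofReal b)⁻¹) *
        (P ^ (b / γ) * M ^ (1 - b / γ))) := by
  have hn : 0 < Module.finrank ℝ E := Module.finrank_pos
  simp only [← ofReal_norm]
  rw [lintegral_fun_norm_addHaar μ (f := fun t => min (P * ENNReal.ofReal t ^ γ) M *
    ENNReal.ofReal t ^ (-b - Module.finrank ℝ E)) (by fun_prop)]
  gcongr
  refine le_of_eq_of_le (setLIntegral_congr_fun measurableSet_Ioi fun t (ht : 0 < t) => ?_)
    (lintegral_rpow_mul_min_le hb hbγ P M)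
  rw [mul_left_comm, mul_comm, ENNReal.ofReal_pow ht.le, ← ENNReal.rpow_natCast,
    ← ENNReal.rpow_add _ _ (by simpa using ht) ENNReal.ofReal_ne_top, Nat.cast_pred hn]
  congr 2
  ring

end Polar

section Duality

variable {E : Type*} [NormedAddCommGroup E] [NormedSpace ℝ E]

/-- A `C¹` function with compact support and values in `[-1, 1]`. Pairings against such functions
compute the `L¹` norm and bound the total variation from below. -/
structure IsTestFunction (φ : E → ℝ) : Prop where
  contDiff : ContDiff ℝ 1 φ
  hasCompactSupport : HasCompactSupport φ
  abs_le_one (x : E) : |φ x| ≤ 1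

theorem IsTestFunction.comp_sub_left {φ : E → ℝ} (hφ : IsTestFunction φ) (a : E) :
    IsTestFunction fun x => φ (a - x) where
  contDiff := hφ.contDiff.comp (contDiff_const.sub contDiff_id)
  hasCompactSupport := hφ.hasCompactSupport.comp_homeomorph (Homeomorph.subLeft a)
  abs_le_one _ := hφ.abs_le_one _

theorem IsTestFunction.fderiv_comp_sub_left {φ : E → ℝ} (hφ : IsTestFunction φ) (a x v : E) :
    fderiv ℝ (fun x => φ (a - x)) x v = fderiv ℝ φ (a - x) (-v) := by
  have h := (hφ.contDiff.differentiable one_ne_zero (a - x)).hasFDerivAt.comp x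
    ((hasFDerivAt_id x).const_sub a)
  rw [Function.comp_def] at h
  simp [h.fderiv]

variable [FiniteDimensional ℝ E] [MeasurableSpace E] [BorelSpace E] {μ : Measure E}
  [μ.IsAddHaarMeasure]

theorem exists_seq_isTestFunction_tendsto_ae {s : E → ℝ} (hs : AEStronglyMeasurable s μ)
    (hs1 : ∀ x, |s x| ≤ 1) {R : ℝ} (hsR : s.support ⊆ Metric.closedBall 0 R) :
    ∃ φ : ℕ → E → ℝ, (∀ n, IsTestFunction (φ n)) ∧
      (∀ n, (φ n).support ⊆ Metric.closedBall 0 (1 + R)) ∧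
      ∀ᵐ x ∂μ, Tendsto (fun n => φ n x) atTop (𝓝 (s x)) := by
  let B (n : ℕ) : ContDiffBump (0 : E) :=
    { rIn := 1 / (2 * (n + 1)), rOut := 1 / (n + 1)
      rIn_pos := by positivity
      rIn_lt_rOut := by gcongr; linarith [n.cast_nonneg (α := ℝ)] }
  have hs_int : LocallyIntegrable s μ :=
    (locallyIntegrable_const (1 : ℝ)).mono hs (.of_forall fun x => by simpa using hs1 x)
  have hsupp (n : ℕ) : ((B n).normed μ ⋆[ContinuousLinearMap.lsmul ℝ ℝ, μ] s).support ⊆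
      Metric.closedBall 0 (1 + R) := by
    refine (support_convolution_subset _).trans (add_subset_iff.2 fun x hx y hy => ?_)
    rw [ContDiffBump.support_normed_eq, mem_ball_zero_iff] at hx
    have hB : (B n).rOut ≤ 1 := by
      simpa [B] using Nat.one_div_le_one_div (α := ℝ) n.zero_le
    rw [mem_closedBall_zero_iff]
    exact (norm_add_le x y).trans
      (add_le_add (hx.le.trans hB) (mem_closedBall_zero_iff.1 (hsR hy)))
  refine ⟨fun n => (B n).normed μ ⋆[ContinuousLinearMap.lsmul ℝ ℝ, μ] s,
    fun n => ⟨?_, ?_, fun x => ?_⟩, hsupp, ?_⟩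
  · exact (B n).hasCompactSupport_normed.contDiff_convolution_left _ (B n).contDiff_normed hs_int
  · exact HasCompactSupport.of_support_subset_isCompact (isCompact_closedBall _ _) (hsupp n)
  · simpa using dist_convolution_le (x₀ := x) (z₀ := 0) zero_le_one (B n).support_normed_eq.subset
      (B n).nonneg_normed (B n).integral_normed hs fun y _ => by simpa using hs1 y
  · refine ContDiffBump.ae_convolution_tendsto_right_of_locallyIntegrable (K := 2)
      tendsto_one_div_add_atTop_nhds_zero_nat (.of_forall fun n => le_of_eq ?_) hs_int
    simp only [B]
    field_simp

theorem setLIntegral_closedBall_enorm_le_of_forall_isTestFunction {w : E → ℝ}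
    (hw : LocallyIntegrable w μ) {c : ℝ≥0∞}
    (hc : ∀ φ : E → ℝ, IsTestFunction φ → ENNReal.ofReal (∫ x, w x * φ x ∂μ) ≤ c) (R : ℝ) :
    ∫⁻ x in Metric.closedBall 0 R, ‖w x‖ₑ ∂μ ≤ c := by
  let s : E → ℝ := (Metric.closedBall 0 R).indicator fun x => w x / |w x|
  have hwm := hw.aestronglyMeasurable
  have hws (x : E) : w x * s x = (Metric.closedBall 0 R).indicator (fun x => ‖w x‖) x := by
    by_cases hx : x ∈ Metric.closedBall 0 R
    · simp only [s, indicator_of_mem hx, ← mul_div_assoc, ← abs_mul_abs_self (w x),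
        mul_self_div_self, Real.norm_eq_abs]
    · simp only [s, indicator_of_notMem hx, mul_zero]
  have hs1 (x : E) : |s x| ≤ 1 := by
    refine (norm_indicator_le_norm_self (fun x => w x / |w x|) x).trans ?_
    simpa using div_self_le_one |w x|
  obtain ⟨φ, hφ, hφR, hlim⟩ := exists_seq_isTestFunction_tendsto_ae
    ((hwm.aemeasurable.div hwm.norm.aemeasurable).aestronglyMeasurable.indicator
      measurableSet_closedBall) hs1 support_indicator_subset
  have hbound (n : ℕ) (x : E) :
      ‖w x * φ n x‖ ≤ (Metric.closedBall 0 (1 + R)).indicator (fun x => ‖w x‖) x := by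
    by_cases hx : x ∈ Metric.closedBall 0 (1 + R)
    · rw [indicator_of_mem hx, norm_mul]
      exact mul_le_of_le_one_right (norm_nonneg _) ((hφ n).abs_le_one x)
    · rw [indicator_of_notMem hx, Function.notMem_support.1 (notMem_subset (hφR n) hx)]
      simp
  have hw_ball (r : ℝ) : IntegrableOn w (Metric.closedBall 0 r) μ :=
    hw.integrableOn_isCompact (isCompact_closedBall _ _)
  have hint : Tendsto (fun n => ∫ x, w x * φ n x ∂μ) atTop
      (𝓝 (∫ x in Metric.closedBall 0 R, ‖w x‖ ∂μ)) := by
    rw [← integral_indicator measurableSet_closedBall]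
    refine tendsto_integral_of_dominated_convergence _
      (fun n => hwm.mul (hφ n).contDiff.continuous.aestronglyMeasurable)
      (IntegrableOn.integrable_indicator (hw_ball (1 + R)).norm measurableSet_closedBall)
      (fun n => .of_forall (hbound n)) ?_
    filter_upwards [hlim] with x hx
    rw [← hws x]
    exact hx.const_mul (w x)
  rw [← ofReal_integral_norm_eq_lintegral_enorm (hw_ball R)]
  exact le_of_tendsto' ((ENNReal.continuous_ofReal.tendsto _).comp hint) fun n => hc _ (hφ n)

theorem lintegral_enorm_le_of_forall_isTestFunction {w : E → ℝ} (hw : LocallyIntegrable w μ)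
    {c : ℝ≥0∞}
    (hc : ∀ φ : E → ℝ, IsTestFunction φ → ENNReal.ofReal (∫ x, w x * φ x ∂μ) ≤ c) :
    ∫⁻ x, ‖w x‖ₑ ∂μ ≤ c :=
  le_of_tendsto' ((aecover_closedBall tendsto_natCast_atTop_atTop).lintegral_tendsto_of_nat
    hw.aestronglyMeasurable.enorm) fun n =>
      setLIntegral_closedBall_enorm_le_of_forall_isTestFunction hw hc n

end Duality

section TotalVariation

variable {d : ℕ} {u : EuclideanSpace ℝ (Fin d) → ℝ} {φ : EuclideanSpace ℝ (Fin d) → ℝ}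

theorem divergence_smul_const (hφ : Differentiable ℝ φ) (v x : EuclideanSpace ℝ (Fin d)) :
    divergence (fun y => φ y • v) x = fderiv ℝ φ x v := by
  have hv : v = ∑ i, v i • EuclideanSpace.single i (1 : ℝ) := by
    ext j; simp [Finset.sum_apply, Pi.single_apply]
  rw [divergence, ((hφ x).hasFDerivAt.smul_const v).fderiv]
  conv_rhs => rw [hv, map_sum]
  simp [mul_comm]

theorem ofReal_integral_mul_fderiv_le_totalVariation (u : EuclideanSpace ℝ (Fin d) → ℝ)
    (hφ : IsTestFunction φ) (v : EuclideanSpace ℝ (Fin d)) :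
    ENNReal.ofReal (∫ x, u x * fderiv ℝ φ x v) ≤ ‖v‖ₑ * totalVariation u := by
  rcases eq_or_ne v 0 with rfl | hv
  · simp
  have hv' : ‖‖v‖⁻¹ • v‖ = 1 := by simp [norm_smul, hv]
  have hint : ∫ x, u x * fderiv ℝ φ x v =
      ‖v‖ * ∫ x, u x * divergence (fun y => φ y • ‖v‖⁻¹ • v) x := by
    simp only [divergence_smul_const (hφ.contDiff.differentiable one_ne_zero), map_smul,
      smul_eq_mul, mul_left_comm _ ‖v‖⁻¹, integral_const_mul]
    rw [inv_mul_cancel_left₀ (norm_ne_zero_iff.2 hv)]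
  rw [hint, ENNReal.ofReal_mul (norm_nonneg _), ofReal_norm]
  gcongr
  refine le_iSup_of_le _ <| le_iSup_of_le (hφ.contDiff.smul contDiff_const) <|
    le_iSup_of_le hφ.hasCompactSupport.smul_right <| le_iSup_of_le (fun x => ?_) le_rfl
  rw [Pi.smul_apply', norm_smul, hv', mul_one]
  exact hφ.abs_le_one x

theorem ofReal_convolution_sub_le (hu : LocallyIntegrable u) (hφ : IsTestFunction φ)
    (h : EuclideanSpace ℝ (Fin d)) :
    ENNReal.ofReal ((u ⋆[ContinuousLinearMap.mul ℝ ℝ] φ) h -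
      (u ⋆[ContinuousLinearMap.mul ℝ ℝ] φ) 0) ≤ ‖h‖ₑ * totalVariation u := by
  rcases eq_or_ne (‖h‖ₑ * totalVariation u) ∞ with htop | htop
  · exact htop ▸ le_top
  have hfderiv := hφ.hasCompactSupport.hasFDerivAt_convolution_right (μ := volume)
    (ContinuousLinearMap.mul ℝ ℝ) hu hφ.contDiff
  have hderiv (s : ℝ) : HasDerivAt
      (fun s : ℝ => (u ⋆[ContinuousLinearMap.mul ℝ ℝ] φ) (s • h))
      (∫ x, u x * fderiv ℝ φ (s • h - x) h) s := by
    have h1 := (hfderiv (s • h)).comp_hasDerivAt s ((hasDerivAt_id s).smul_const h)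
    rw [one_smul, convolution_precompR_apply _ hu (hφ.hasCompactSupport.fderiv ℝ)
      (hφ.contDiff.continuous_fderiv one_ne_zero)] at h1
    exact h1
  have hbound (s : ℝ) : ∫ x, u x * fderiv ℝ φ (s • h - x) h ≤
      (‖h‖ₑ * totalVariation u).toReal := by
    rw [← ENNReal.ofReal_le_iff_le_toReal htop]
    simpa [hφ.fderiv_comp_sub_left] using
      ofReal_integral_mul_fderiv_le_totalVariation u (hφ.comp_sub_left (s • h)) (-h)
  have hmean := image_sub_le_mul_sub_of_deriv_le (fun s => (hderiv s).differentiableAt)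
    (fun s => (hderiv s).deriv.trans_le (hbound s)) zero_le_one
  rw [ENNReal.ofReal_le_iff_le_toReal htop]
  simpa using hmean

theorem lintegral_enorm_translate_sub_le (hu : LocallyIntegrable u)
    (h : EuclideanSpace ℝ (Fin d)) :
    ∫⁻ x, ‖u (x + h) - u x‖ₑ ≤ ‖h‖ₑ * totalVariation u := by
  have hu_h : LocallyIntegrable fun x => u (x + h) := by
    rw [← map_add_right_eq_self volume h] at hu
    exact (locallyIntegrable_map_homeomorph (Homeomorph.addRight h)).1 hu
  refine lintegral_enorm_le_of_forall_isTestFunction (hu_h.sub hu) fun φ hφ => ?_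
  have hmul {w : EuclideanSpace ℝ (Fin d) → ℝ} (hw : LocallyIntegrable w) :
      Integrable fun x => w x * φ x :=
    hw.integrable_smul_right_of_hasCompactSupport hφ.contDiff.continuous hφ.hasCompactSupport
  have hconv : ∫ x, (u (x + h) - u x) * φ x =
      (u ⋆[ContinuousLinearMap.mul ℝ ℝ] fun x => φ (0 - x)) h -
        (u ⋆[ContinuousLinearMap.mul ℝ ℝ] fun x => φ (0 - x)) 0 := by
    simp only [sub_mul, convolution_def, ContinuousLinearMap.mul_apply', zero_sub, neg_sub,
      neg_neg]
    rw [integral_sub (hmul hu_h) (hmul hu),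
      ← integral_add_right_eq_self (fun x => u x * φ (x - h)) h]
    simp only [add_sub_cancel_right]
  simp only [Pi.sub_apply, hconv]
  exact ofReal_convolution_sub_le hu (hφ.comp_sub_left 0) h

end TotalVariation

theorem ofReal_one_div_nat_add_one_mul (n : ℕ) :
    ENNReal.ofReal (1 / (n + 1)) * (n + 1) = 1 := by
  rw [show (n + 1 : ℝ≥0∞) = ENNReal.ofReal (n + 1) by
      rw [ENNReal.ofReal_add n.cast_nonneg zero_le_one, ENNReal.ofReal_natCast, ENNReal.ofReal_one],
    ← ENNReal.ofReal_mul (by positivity), one_div_mul_cancel (by positivity), ENNReal.ofReal_one]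

section Subadditive

variable {E : Type*} [NormedAddCommGroup E] [NormedSpace ℝ E] {ψ : E → ℝ≥0∞}

theorem mul_ofReal_le_of_subadditive (h0 : ψ 0 = 0) (hadd : ∀ h k, ψ (h + k) ≤ ψ h + ψ k) {ρ : ℝ}
    (hρ : 0 < ρ) {a : ℝ≥0∞} (ha : ∀ k, ‖k‖ ≤ ρ → ψ k ≤ a) {h : E} (hh : ρ ≤ ‖h‖) :
    ψ h * ENNReal.ofReal ρ ≤ 2 * a * ‖h‖ₑ := by
  set N := ⌈‖h‖ / ρ⌉₊
  have hN0 : 0 < (N : ℝ) := Nat.cast_pos.2 (Nat.ceil_pos.2 (div_pos (hρ.trans_le hh) hρ))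
  have hN_lower : ‖h‖ ≤ N * ρ := (div_le_iff₀ hρ).1 (Nat.le_ceil _)
  have hN_upper : N * ρ ≤ 2 * ‖h‖ := by
    have hlt : (N : ℝ) < ‖h‖ / ρ + 1 := Nat.ceil_lt_add_one (by positivity)
    have hle : N * ρ ≤ (‖h‖ / ρ + 1) * ρ := by gcongr
    rw [add_mul, div_mul_cancel₀ _ hρ.ne'] at hle
    linarith
  have hsmul : ψ h ≤ N * ψ ((N : ℝ)⁻¹ • h) := by
    have hsum := Finset.le_sum_of_subadditive ψ h0.le hadd (Finset.range N) fun _ => (N : ℝ)⁻¹ • h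
    simpa [← Nat.cast_smul_eq_nsmul ℝ, smul_smul, mul_inv_cancel₀ hN0.ne'] using hsum
  have hsmall : ‖(N : ℝ)⁻¹ • h‖ ≤ ρ := by
    rwa [norm_smul, norm_inv, Real.norm_natCast, inv_mul_le_iff₀ hN0]
  calc ψ h * ENNReal.ofReal ρ
      ≤ N * a * ENNReal.ofReal ρ := by gcongr; exact hsmul.trans (by gcongr; exact ha _ hsmall)
    _ = a * ENNReal.ofReal (N * ρ) := by
        rw [ENNReal.ofReal_mul hN0.le, ENNReal.ofReal_natCast]; ring
    _ ≤ a * ENNReal.ofReal (2 * ‖h‖) := by gcongr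
    _ = 2 * a * ‖h‖ₑ := by
        rw [ENNReal.ofReal_mul zero_le_two, ofReal_norm, ENNReal.ofReal_ofNat]; ring

variable [FiniteDimensional ℝ E] [MeasurableSpace E] [BorelSpace E] (μ : Measure E)
  [μ.IsAddHaarMeasure]

theorem addHaar_ball_eq_two_pow_mul (ρ : ℝ) :
    μ (Metric.ball (0 : E) ρ) = 2 ^ Module.finrank ℝ E * μ (Metric.ball (0 : E) (ρ / 2)) := by
  have h := Measure.addHaar_ball_mul_of_pos μ (0 : E) (zero_lt_two' ℝ) (ρ / 2)
  rwa [mul_div_cancel₀ _ two_ne_zero, ENNReal.ofReal_pow zero_le_two, ENNReal.ofReal_ofNat] at h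

theorem mul_measure_ball_le_of_subadditive (hψ : Measurable ψ)
    (hadd : ∀ h k, ψ (h + k) ≤ ψ h + ψ k) {ρ : ℝ} {h : E} (hh : ‖h‖ ≤ ρ) :
    ψ h * μ (Metric.ball 0 (ρ / 2)) ≤ 2 * ∫⁻ k in Metric.ball (0 : E) ρ, ψ k ∂μ := by
  set B := Metric.ball ((2 : ℝ)⁻¹ • h) (ρ / 2) with hB
  have hcenter : ‖(2 : ℝ)⁻¹ • h‖ ≤ ρ / 2 := by
    rw [norm_smul, norm_inv, Real.norm_ofNat]; linarith
  have hleft : B ⊆ Metric.ball 0 ρ := Metric.ball_subset_ball' (by rw [dist_zero_right]; linarith)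
  -- The point reflection `k ↦ h - k` preserves `B`.
  have hright {k : E} (hk : k ∈ B) : h - k ∈ Metric.ball 0 ρ := hleft <| by
    rw [hB, mem_ball_iff_norm] at hk ⊢
    rwa [← norm_neg, show -(h - k - (2 : ℝ)⁻¹ • h) = k - (2 : ℝ)⁻¹ • h by module]
  calc ψ h * μ (Metric.ball 0 (ρ / 2)) = ∫⁻ _ in B, ψ h ∂μ := by
        rw [setLIntegral_const, hB, Measure.addHaar_ball_center μ ((2 : ℝ)⁻¹ • h)]
    _ ≤ ∫⁻ k in B, (Metric.ball (0 : E) ρ).indicator ψ k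
          + (Metric.ball (0 : E) ρ).indicator ψ (h - k) ∂μ := by
        refine setLIntegral_mono' measurableSet_ball fun k hk => ?_
        rw [indicator_of_mem (hleft hk), indicator_of_mem (hright hk)]
        simpa using hadd k (h - k)
    _ ≤ ∫⁻ k, (Metric.ball (0 : E) ρ).indicator ψ k
          + (Metric.ball (0 : E) ρ).indicator ψ (h - k) ∂μ := setLIntegral_le_lintegral _ _
    _ = 2 * ∫⁻ k in Metric.ball (0 : E) ρ, ψ k ∂μ := by
        rw [lintegral_add_left (hψ.indicator measurableSet_ball),
          lintegral_sub_left_eq_self (fun k => (Metric.ball (0 : E) ρ).indicator ψ k) h,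
          lintegral_indicator measurableSet_ball, two_mul]

theorem le_setLAverage_ball_of_subadditive (hψ : Measurable ψ)
    (hadd : ∀ h k, ψ (h + k) ≤ ψ h + ψ k) {ρ : ℝ} (hρ : 0 < ρ) {h : E} (hh : ‖h‖ ≤ ρ) :
    ψ h ≤ 2 ^ (Module.finrank ℝ E + 1) * ⨍⁻ k in Metric.ball (0 : E) ρ, ψ k ∂μ := by
  have hb0 : μ (Metric.ball (0 : E) (ρ / 2)) ≠ 0 :=
    (Metric.measure_ball_pos μ _ (by positivity)).ne'
  have hbt : μ (Metric.ball (0 : E) (ρ / 2)) ≠ ∞ := measure_ball_lt_top.ne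
  rw [← ENNReal.mul_le_mul_iff_left hb0 hbt]
  refine (mul_measure_ball_le_of_subadditive μ hψ hadd hh).trans_eq ?_
  rw [← measure_mul_setLAverage _ measure_ball_lt_top.ne, addHaar_ball_eq_two_pow_mul μ ρ]
  ring

/-- The lower limit, as `ρ → 0`, of the mean of `ψ` over the ball of radius `ρ` about the origin
divided by `ρ`; for subadditive `ψ` it plays the part of a Lipschitz constant at the origin. -/
noncomputable def meanSlope (ψ : E → ℝ≥0∞) : ℝ≥0∞ :=
  liminf (fun n : ℕ => (⨍⁻ k in Metric.ball (0 : E) (1 / (n + 1)), ψ k ∂μ) * (n + 1)) atTop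

theorem le_meanSlope_mul_enorm (hψ : Measurable ψ) (h0 : ψ 0 = 0)
    (hadd : ∀ h k, ψ (h + k) ≤ ψ h + ψ k) (h : E) :
    ψ h ≤ 2 ^ (Module.finrank ℝ E + 2) * meanSlope μ ψ * ‖h‖ₑ := by
  rcases eq_or_ne h 0 with rfl | hh
  · simp [h0]
  have hc0 : 2 ^ (Module.finrank ℝ E + 2) * ‖h‖ₑ ≠ 0 := by simp [hh]
  have hct : 2 ^ (Module.finrank ℝ E + 2) * ‖h‖ₑ ≠ ∞ := by finiteness
  rw [mul_right_comm, mul_comm, ← ENNReal.div_le_iff hc0 hct]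
  refine le_liminf_of_le (by isBoundedDefault) ?_
  filter_upwards [tendsto_one_div_add_atTop_nhds_zero_nat.eventually_lt_const (norm_pos_iff.2 hh)]
    with n hn
  have hρ : (0 : ℝ) < 1 / (n + 1) := by positivity
  rw [ENNReal.div_le_iff hc0 hct]
  calc ψ h = ψ h * ENNReal.ofReal (1 / (n + 1)) * (n + 1) := by
        rw [mul_assoc, ofReal_one_div_nat_add_one_mul, mul_one]
    _ ≤ 2 * (2 ^ (Module.finrank ℝ E + 1) * ⨍⁻ k in Metric.ball 0 (1 / (n + 1)), ψ k ∂μ) * ‖h‖ₑ *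
          (n + 1) := by
        gcongr ?_ * _
        exact mul_ofReal_le_of_subadditive h0 hadd hρ
          (fun k hk => le_setLAverage_ball_of_subadditive μ hψ hadd hρ hk) hn.le
    _ = _ := by ring

end Subadditive

theorem measurableSet_mem_uIoc {X : Type*} [MeasurableSpace X] {f a b : X → ℝ} (hf : Measurable f)
    (ha : Measurable a) (hb : Measurable b) : MeasurableSet {x | f x ∈ uIoc (a x) (b x)} := by
  simp only [mem_uIoc]
  exact ((measurableSet_lt ha hf).inter (measurableSet_le hf hb)).union
    ((measurableSet_lt hb hf).inter (measurableSet_le hf ha))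

theorem abs_le_or_abs_le_of_mem_uIoc {τ a b : ℝ} (h : τ ∈ uIoc a b) : |τ| ≤ |a| ∨ |τ| ≤ |b| :=
  le_max_iff.1 <| (mem_uIoc.1 h).elim (fun h => abs_le_max_abs_abs h.1.le h.2)
    fun h => max_comm |b| |a| ▸ abs_le_max_abs_abs h.1.le h.2

/-- The measure of `{τ ≤ |u|}`. -/
def levelMeasure {X : Type*} [MeasurableSpace X] (μ : Measure X) (u : X → ℝ) (τ : ℝ) : ℝ≥0∞ :=
  μ {x | |τ| ≤ |u x|}

/-- The measure of the symmetric difference of the superlevel set `{τ ≤ u}` and its translate by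
`-h`, that is, of the points `x` such that `τ` separates `u x` from `u (x + h)`. -/
def levelShift {E : Type*} [Add E] [MeasurableSpace E] (μ : Measure E) (u : E → ℝ) (τ : ℝ)
    (h : E) : ℝ≥0∞ :=
  μ {x | τ ∈ uIoc (u x) (u (x + h))}

section LevelShift

variable {E : Type*} [AddGroup E] [MeasurableSpace E] (μ : Measure E) {u : E → ℝ}

theorem levelShift_zero (τ : ℝ) : levelShift μ u τ 0 = 0 := by
  simp [levelShift]

variable [MeasurableAdd₂ E]

theorem levelShift_add_le [μ.IsAddRightInvariant] (τ : ℝ) (h k : E) :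
    levelShift μ u τ (h + k) ≤ levelShift μ u τ h + levelShift μ u τ k := by
  have hshift : levelShift μ u τ k = μ {x | τ ∈ uIoc (u (x + h)) (u (x + h + k))} :=
    (measure_preimage_add_right μ h _).symm
  rw [hshift, levelShift, levelShift]
  refine (measure_mono fun x hx => ?_).trans (measure_union_le _ _)
  simp only [mem_union, mem_ofPred_eq, mem_uIoc, ← add_assoc] at hx ⊢
  grind

theorem levelShift_le_two_mul_levelMeasure [μ.IsAddRightInvariant] (τ : ℝ) (h : E) :
    levelShift μ u τ h ≤ 2 * levelMeasure μ u τ := by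
  have hshift : levelMeasure μ u τ = μ {x | |τ| ≤ |u (x + h)|} :=
    (measure_preimage_add_right μ h _).symm
  rw [two_mul]
  nth_rewrite 2 [hshift]
  refine (measure_mono fun x hx => ?_).trans (measure_union_le _ _)
  exact abs_le_or_abs_le_of_mem_uIoc hx

variable [SFinite μ] (hu : Measurable u)
include hu

theorem measurable_levelShift : Measurable fun p : ℝ × E => levelShift μ u p.1 p.2 :=
  measurable_measure_prodMk_left (measurableSet_mem_uIoc (f := fun q : (ℝ × E) × E => q.1.1)
    (a := fun q => u q.2) (b := fun q => u (q.2 + q.1.2))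
    (by fun_prop) (by fun_prop) (by fun_prop))

theorem lintegral_levelShift (h : E) :
    ∫⁻ τ, levelShift μ u τ h = ∫⁻ x, ‖u (x + h) - u x‖ₑ ∂μ := by
  have hS : MeasurableSet {p : ℝ × E | p.1 ∈ uIoc (u p.2) (u (p.2 + h))} :=
    measurableSet_mem_uIoc (by fun_prop) (by fun_prop) (by fun_prop)
  calc ∫⁻ τ, levelShift μ u τ h
      = (volume.prod μ) {p : ℝ × E | p.1 ∈ uIoc (u p.2) (u (p.2 + h))} :=
        (Measure.prod_apply hS).symm
    _ = ∫⁻ x, volume (uIoc (u x) (u (x + h))) ∂μ := Measure.prod_apply_symm hS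
    _ = _ := by simp only [Real.volume_uIoc, ← Real.norm_eq_abs, ofReal_norm]

end LevelShift

section LevelVariation

variable {E : Type*} [NormedAddCommGroup E] [NormedSpace ℝ E] [FiniteDimensional ℝ E]
  [MeasurableSpace E] [BorelSpace E] (μ : Measure E) [μ.IsAddHaarMeasure]

/-- A substitute for the perimeter of `{τ ≤ u}`: it dominates `levelShift μ u τ h / ‖h‖`, and its
integral over `τ` is controlled by the variation of `u`. -/
noncomputable def levelVariation (u : E → ℝ) (τ : ℝ) : ℝ≥0∞ :=
  2 ^ (Module.finrank ℝ E + 2) * meanSlope μ (levelShift μ u τ)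

variable {u : E → ℝ} (hu : Measurable u)
include hu

theorem levelShift_le_levelVariation_mul_enorm (τ : ℝ) (h : E) :
    levelShift μ u τ h ≤ levelVariation μ u τ * ‖h‖ₑ :=
  le_meanSlope_mul_enorm μ ((measurable_levelShift μ hu).comp measurable_prodMk_left)
    (levelShift_zero μ τ) (levelShift_add_le μ τ) h

theorem measurable_setLAverage_levelShift (ρ : ℝ) :
    Measurable fun τ => ⨍⁻ k in Metric.ball (0 : E) ρ, levelShift μ u τ k ∂μ := by
  simp only [setLAverage_eq]
  exact (measurable_levelShift μ hu).lintegral_prod_right'.div_const _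

theorem measurable_levelVariation : Measurable (levelVariation μ u) :=
  (Measurable.liminf fun _ =>
    (measurable_setLAverage_levelShift μ hu _).mul_const _).const_mul _

theorem lintegral_setLAverage_levelShift_le {V : ℝ≥0∞}
    (hV : ∀ h, ∫⁻ x, ‖u (x + h) - u x‖ₑ ∂μ ≤ ‖h‖ₑ * V) {ρ : ℝ} (hρ : 0 < ρ) :
    ∫⁻ τ, ⨍⁻ k in Metric.ball (0 : E) ρ, levelShift μ u τ k ∂μ ≤ ENNReal.ofReal ρ * V := by
  have hb0 : μ (Metric.ball (0 : E) ρ) ≠ 0 := (Metric.measure_ball_pos μ _ hρ).ne'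
  simp only [setLAverage_eq, ENNReal.div_eq_inv_mul]
  rw [lintegral_const_mul' _ _ (by simp [hb0]), ← ENNReal.div_eq_inv_mul]
  refine ENNReal.div_le_of_le_mul ?_
  rw [lintegral_lintegral_swap (measurable_levelShift μ hu).aemeasurable, ← setLIntegral_const]
  refine setLIntegral_mono' measurableSet_ball fun k hk => ?_
  rw [lintegral_levelShift μ hu]
  refine (hV k).trans ?_
  gcongr
  rw [← ofReal_norm]
  exact ENNReal.ofReal_le_ofReal (mem_ball_zero_iff.1 hk).le

theorem lintegral_levelVariation_le {V : ℝ≥0∞}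
    (hV : ∀ h, ∫⁻ x, ‖u (x + h) - u x‖ₑ ∂μ ≤ ‖h‖ₑ * V) :
    ∫⁻ τ, levelVariation μ u τ ≤ 2 ^ (Module.finrank ℝ E + 2) * V := by
  simp only [levelVariation, meanSlope]
  rw [lintegral_const_mul' _ _ (by finiteness)]
  gcongr
  refine (lintegral_liminf_le fun _ =>
    (measurable_setLAverage_levelShift μ hu _).mul_const _).trans ?_
  refine liminf_le_of_frequently_le' (.of_forall fun n => ?_)
  rw [lintegral_mul_const' _ _ (by finiteness)]
  calc _ ≤ ENNReal.ofReal (1 / (n + 1)) * V * (n + 1) := by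
        gcongr
        exact lintegral_setLAverage_levelShift_le μ hu hV (by positivity)
    _ = V := by
        rw [mul_right_comm, ofReal_one_div_nat_add_one_mul, one_mul]

end LevelVariation

theorem volume_restrict_Ioi_ofReal_le (a : ℝ≥0∞) :
    volume.restrict (Ioi 0) {t : ℝ | ENNReal.ofReal t ≤ a} = a := by
  rw [Measure.restrict_apply (measurableSet_le (by fun_prop) (by fun_prop))]
  rcases eq_or_ne a ∞ with rfl | ha
  · simp
  have hset : {t : ℝ | ENNReal.ofReal t ≤ a} ∩ Ioi 0 = Ioc 0 a.toReal := by
    ext t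
    exact and_comm.trans (and_congr_right' (ENNReal.ofReal_le_iff_le_toReal ha))
  rw [hset, Real.volume_Ioc, sub_zero, ENNReal.ofReal_toReal ha]

theorem volume_restrict_Ioi_ofReal_lt (a : ℝ≥0∞) :
    volume.restrict (Ioi 0) {t : ℝ | ENNReal.ofReal t < a} = a := by
  have h := setLIntegral_ofReal_lt_rpow one_pos a
  simp only [sub_self, ENNReal.rpow_zero, setLIntegral_one, ENNReal.rpow_one, ENNReal.ofReal_one,
    div_one] at h
  rw [Measure.restrict_apply (measurableSet_lt (by fun_prop) (by fun_prop)), inter_comm]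
  exact h

section Rearrangement

variable {X : Type*} [MeasurableSpace X] {μ : Measure X} {f g : X → ℝ≥0∞}

theorem distribution_congr_ae (h : f =ᵐ[μ] g) : distribution μ f = distribution μ g := by
  funext y
  refine measure_congr ?_
  filter_upwards [h] with x hx
  exact propext (by change y < f x ↔ y < g x; rw [hx])

theorem lorentzNorm_congr_ae (h : f =ᵐ[μ] g) (q r : ℝ) :
    lorentzNorm μ q r f = lorentzNorm μ q r g := by
  unfold lorentzNorm maximalRearrangement rearrangement
  rw [distribution_congr_ae h]

theorem rearrangement_antitone (f : X → ℝ≥0∞) : Antitone (rearrangement μ f) :=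
  fun _ _ hst => sInf_le_sInf fun _ hy => lt_of_lt_of_le hy (ENNReal.ofReal_le_ofReal hst)

theorem rearrangement_le_const_add {y : ℝ≥0∞} (h : ∀ x, f x ≤ y + g x) (s : ℝ) :
    rearrangement μ f s ≤ y + rearrangement μ g s := by
  rw [← tsub_le_iff_left]
  refine le_sInf fun z hz => ?_
  rw [tsub_le_iff_left]
  refine sInf_le (lt_of_le_of_lt (measure_mono fun x (hx : y + z < f x) => ?_) hz)
  exact lt_of_add_lt_add_left (hx.trans_le (h x))

theorem ofReal_le_distribution_of_lt_rearrangement {y : ℝ≥0∞} {s : ℝ}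
    (h : y < rearrangement μ f s) : ENNReal.ofReal s ≤ distribution μ f y :=
  not_lt.1 fun hlt => h.not_ge (sInf_le hlt)

theorem le_rearrangement_of_ofReal_le {z : ℝ≥0∞} {t : ℝ}
    (h : ENNReal.ofReal t ≤ μ {x | z ≤ f x}) : z ≤ rearrangement μ f t :=
  le_sInf fun _ hy => not_lt.1 fun hyz =>
    (h.trans (measure_mono fun _ hx => hyz.trans_le hx)).not_gt hy

theorem mul_rearrangement_le_setLIntegral (t : ℝ) :
    ENNReal.ofReal t * rearrangement μ f t ≤ ∫⁻ s in Ioc 0 t, rearrangement μ f s := by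
  calc ENNReal.ofReal t * rearrangement μ f t = ∫⁻ _ in Ioc 0 t, rearrangement μ f t := by
        rw [setLIntegral_const, Real.volume_Ioc, sub_zero, mul_comm]
    _ ≤ _ := setLIntegral_mono' measurableSet_Ioc fun s hs => rearrangement_antitone f hs.2

theorem lorentzNorm_one_eq (q : ℝ) (f : X → ℝ≥0∞) :
    lorentzNorm μ q 1 f = ∫⁻ t in Ioi (0 : ℝ), ENNReal.ofReal t ^ (1 / q - 1 - 1) *
      ∫⁻ s in Ioc 0 t, rearrangement μ f s := by
  simp only [lorentzNorm, maximalRearrangement, ENNReal.rpow_one, div_one]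
  refine setLIntegral_congr_fun measurableSet_Ioi fun t (ht : 0 < t) => ?_
  have h0 : ENNReal.ofReal t ≠ 0 := by simpa using ht
  rw [ENNReal.rpow_sub _ _ h0 ENNReal.ofReal_ne_top, ENNReal.rpow_sub _ _ h0 ENNReal.ofReal_ne_top,
    ENNReal.rpow_one]
  simp only [div_eq_mul_inv]
  ring

theorem setLIntegral_rpow_mul_rearrangement_le_lorentzNorm (q : ℝ) (f : X → ℝ≥0∞) :
    ∫⁻ t in Ioi (0 : ℝ), ENNReal.ofReal t ^ (1 / q - 1) * rearrangement μ f t ≤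
      lorentzNorm μ q 1 f := by
  rw [lorentzNorm_one_eq]
  refine setLIntegral_mono' measurableSet_Ioi fun t (ht : 0 < t) => ?_
  have h0 : ENNReal.ofReal t ≠ 0 := by simpa using ht
  calc ENNReal.ofReal t ^ (1 / q - 1) * rearrangement μ f t
      = ENNReal.ofReal t ^ (1 / q - 1 - 1) * (ENNReal.ofReal t * rearrangement μ f t) := by
        rw [← mul_assoc, ENNReal.rpow_sub (1 / q - 1) 1 h0 ENNReal.ofReal_ne_top, ENNReal.rpow_one,
          ENNReal.div_mul_cancel h0 ENNReal.ofReal_ne_top]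
    _ ≤ _ := by gcongr; exact mul_rearrangement_le_setLIntegral t

theorem lintegral_measure_ofReal_lt [SFinite μ] (hf : Measurable f) :
    ∫⁻ y in Ioi (0 : ℝ), μ {x | ENNReal.ofReal y < f x} = ∫⁻ x, f x ∂μ := by
  have hS : MeasurableSet {p : ℝ × X | ENNReal.ofReal p.1 < f p.2} :=
    measurableSet_lt (by fun_prop) (by fun_prop)
  refine (Measure.prod_apply hS).symm.trans ((Measure.prod_apply_symm hS).trans ?_)
  exact lintegral_congr fun x => volume_restrict_Ioi_ofReal_lt (f x)

theorem lintegral_measure_ofReal_le [SFinite μ] (hf : Measurable f) :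
    ∫⁻ y in Ioi (0 : ℝ), μ {x | ENNReal.ofReal y ≤ f x} = ∫⁻ x, f x ∂μ := by
  have hS : MeasurableSet {p : ℝ × X | ENNReal.ofReal p.1 ≤ f p.2} :=
    measurableSet_le (by fun_prop) (by fun_prop)
  refine (Measure.prod_apply hS).symm.trans ((Measure.prod_apply_symm hS).trans ?_)
  exact lintegral_congr fun x => volume_restrict_Ioi_ofReal_le (f x)

theorem lintegral_rearrangement_le [SFinite μ] (hf : Measurable f) :
    ∫⁻ s in Ioi (0 : ℝ), rearrangement μ f s ≤ ∫⁻ x, f x ∂μ := by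
  rw [← lintegral_measure_ofReal_lt (rearrangement_antitone f).measurable,
    ← lintegral_measure_ofReal_lt hf]
  refine lintegral_mono fun y => ?_
  rw [← volume_restrict_Ioi_ofReal_le (μ {x | ENNReal.ofReal y < f x})]
  exact measure_mono fun s hs => ofReal_le_distribution_of_lt_rearrangement hs

theorem lintegral_measure_rpow_le_lorentzNorm {q : ℝ} (hq : 0 < q) (f : X → ℝ≥0∞) :
    ∫⁻ z in Ioi (0 : ℝ), μ {x | ENNReal.ofReal z ≤ f x} ^ (1 / q) ≤
      ENNReal.ofReal (1 / q) * lorentzNorm μ q 1 f := by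
  have hκ : 0 < 1 / q := by positivity
  have hr : Measurable (rearrangement μ f) := (rearrangement_antitone f).measurable
  let w (t : ℝ) : ℝ≥0∞ := ENNReal.ofReal t ^ (1 / q - 1)
  have hw : Measurable w := by fun_prop
  set ν := (volume.restrict (Ioi 0)).withDensity w
  have hν (a : ℝ≥0∞) : ν {t | ENNReal.ofReal t < a} = a ^ (1 / q) / ENNReal.ofReal (1 / q) := by
    have hm : MeasurableSet {t : ℝ | ENNReal.ofReal t < a} :=
      measurableSet_lt (by fun_prop) (by fun_prop)
    rw [withDensity_apply _ hm, Measure.restrict_restrict hm, inter_comm]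
    exact setLIntegral_ofReal_lt_rpow hκ a
  rw [← ENNReal.div_le_iff' (by simpa using hq) ENNReal.ofReal_ne_top, div_eq_mul_inv,
    ← lintegral_mul_const' _ _ (by simpa using hq)]
  calc ∫⁻ z in Ioi (0 : ℝ), μ {x | ENNReal.ofReal z ≤ f x} ^ (1 / q) * (ENNReal.ofReal (1 / q))⁻¹
      = ∫⁻ z in Ioi (0 : ℝ), ν {t | ENNReal.ofReal t < μ {x | ENNReal.ofReal z ≤ f x}} := by
        simp only [hν, div_eq_mul_inv]
    _ ≤ ∫⁻ z in Ioi (0 : ℝ), ν {t | ENNReal.ofReal z ≤ rearrangement μ f t} :=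
        lintegral_mono fun z => measure_mono fun t ht => le_rearrangement_of_ofReal_le (le_of_lt ht)
    _ = ∫⁻ t in Ioi (0 : ℝ), w t * rearrangement μ f t := by
        rw [lintegral_measure_ofReal_le hr, lintegral_withDensity_eq_lintegral_mul _ hw hr]
        rfl
    _ ≤ lorentzNorm μ q 1 f := setLIntegral_rpow_mul_rearrangement_le_lorentzNorm q f

theorem setLIntegral_rearrangement_le_of_le_const_add [SFinite μ] (hg : Measurable g) {y : ℝ≥0∞}
    (h : ∀ x, f x ≤ y + g x) (t : ℝ) :
    ∫⁻ s in Ioc 0 t, rearrangement μ f s ≤ ENNReal.ofReal t * y + ∫⁻ x, g x ∂μ := by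
  calc ∫⁻ s in Ioc 0 t, rearrangement μ f s
      ≤ ∫⁻ s in Ioc 0 t, (y + rearrangement μ g s) :=
        lintegral_mono fun s => rearrangement_le_const_add h s
    _ = ENNReal.ofReal t * y + ∫⁻ s in Ioc 0 t, rearrangement μ g s := by
        rw [lintegral_add_left measurable_const, setLIntegral_const, Real.volume_Ioc, sub_zero,
          mul_comm]
    _ ≤ ENNReal.ofReal t * y + ∫⁻ s in Ioi (0 : ℝ), rearrangement μ g s := by
        gcongr
        exact Ioc_subset_Ioi_self
    _ ≤ _ := by gcongr; exact lintegral_rearrangement_le hg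

theorem setLIntegral_rearrangement_lintegral_le [SFinite μ] {Y : Type*} [MeasurableSpace Y]
    {ν : Measure Y} [SFinite ν] {F : X → Y → ℝ≥0∞} (hF : Measurable (Function.uncurry F))
    {B : Y → ℝ≥0∞} (hB : Measurable B) (hFB : ∀ x p, F x p ≤ B p) (t : ℝ) :
    ∫⁻ s in Ioc 0 t, rearrangement μ (fun x => ∫⁻ p, F x p ∂ν) s ≤
      ∫⁻ p, min (ENNReal.ofReal t * B p) (∫⁻ x, F x p ∂μ) ∂ν := by
  have hI : Measurable fun p => ∫⁻ x, F x p ∂μ := hF.lintegral_prod_left'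
  set A := {p | ENNReal.ofReal t * B p < ∫⁻ x, F x p ∂μ}
  have hA : MeasurableSet A := measurableSet_lt (by fun_prop) hI
  -- Split the integral at `A`: use the `L^∞` bound on `A` and the `L¹` bound off `A`.
  have hsplit (x : X) : ∫⁻ p, F x p ∂ν ≤ ∫⁻ p in A, B p ∂ν + ∫⁻ p in Aᶜ, F x p ∂ν := by
    rw [← lintegral_add_compl _ hA]
    gcongr with p
    exact hFB x p
  refine (setLIntegral_rearrangement_le_of_le_const_add hF.lintegral_prod_right hsplit t).trans ?_
  rw [← lintegral_const_mul _ hB, lintegral_lintegral_swap hF.aemeasurable,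
    ← lintegral_add_compl (fun p => min _ _) hA]
  refine add_le_add (setLIntegral_mono' hA fun p hp => ?_)
    (setLIntegral_mono' hA.compl fun p hp => ?_)
  · exact le_min le_rfl (le_of_lt hp)
  · exact le_min (not_lt.1 hp) le_rfl

end Rearrangement

theorem lintegral_indicator_uIoc_const (a b : ℝ) (c : ℝ≥0∞) :
    ∫⁻ τ, (uIoc a b).indicator (fun _ => c) τ = ‖b - a‖ₑ * c := by
  rw [lintegral_indicator_const measurableSet_uIoc, Real.volume_uIoc, ← Real.norm_eq_abs,
    ofReal_norm, mul_comm]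

theorem lintegral_levelMeasure_rpow_le {X : Type*} [MeasurableSpace X] (μ : Measure X) (u : X → ℝ)
    {q : ℝ} (hq : 0 < q) :
    ∫⁻ τ, levelMeasure μ u τ ^ (1 / q) ≤
      2 * (ENNReal.ofReal (1 / q) * lorentzNorm μ q 1 fun x => ‖u x‖ₑ) := by
  have hpos : ∫⁻ τ in Ioi (0 : ℝ), levelMeasure μ u τ ^ (1 / q) ≤
      ENNReal.ofReal (1 / q) * lorentzNorm μ q 1 fun x => ‖u x‖ₑ := by
    refine le_trans (le_of_eq ?_) (lintegral_measure_rpow_le_lorentzNorm hq _)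
    refine setLIntegral_congr_fun measurableSet_Ioi fun τ (hτ : 0 < τ) => ?_
    simp only [levelMeasure, abs_of_pos hτ, ← ofReal_norm, Real.norm_eq_abs,
      ENNReal.ofReal_le_ofReal_iff (abs_nonneg _)]
  have hneg : ∫⁻ τ in Iic (0 : ℝ), levelMeasure μ u τ ^ (1 / q) =
      ∫⁻ τ in Ioi (0 : ℝ), levelMeasure μ u τ ^ (1 / q) := by
    rw [← setLIntegral_congr Iio_ae_eq_Iic, ← lintegral_indicator measurableSet_Iio,
      ← lintegral_indicator measurableSet_Ioi, ← lintegral_neg_eq_self]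
    refine lintegral_congr fun τ => ?_
    simp [indicator, levelMeasure]
  rw [← lintegral_add_compl _ measurableSet_Iic (A := Iic (0 : ℝ)), compl_Iic, hneg, ← two_mul]
  gcongr

theorem measurable_levelMeasure {X : Type*} [MeasurableSpace X] (μ : Measure X) [SFinite μ]
    {u : X → ℝ} (hu : Measurable u) : Measurable (levelMeasure μ u) :=
  measurable_measure_prodMk_left (s := {p : ℝ × X | |p.1| ≤ |u p.2|})
    (measurableSet_le (by fun_prop) (by fun_prop))

section DifferenceIntegral

variable {E : Type*} [NormedAddCommGroup E] [NormedSpace ℝ E] [MeasurableSpace E] (μ : Measure E)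

/-- The operator `u ↦ 𝒟^s(u)` on a finite-dimensional space `E`, written in terms of the increments
`h = y - x`. -/
noncomputable def differenceIntegral (s : ℝ) (u : E → ℝ) (x : E) : ℝ≥0∞ :=
  ∫⁻ h, ‖u (x + h) - u x‖ₑ * ‖h‖ₑ ^ (-s - Module.finrank ℝ E) ∂μ

variable [FiniteDimensional ℝ E] [BorelSpace E] [μ.IsAddHaarMeasure]

theorem setLIntegral_rearrangement_differenceIntegral_le (s : ℝ) {u : E → ℝ} (hu : Measurable u)
    (t : ℝ) :
    ∫⁻ r in Ioc 0 t, rearrangement μ (differenceIntegral μ s u) r ≤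
      ∫⁻ τ, ∫⁻ h, min (ENNReal.ofReal t) (levelShift μ u τ h) *
        ‖h‖ₑ ^ (-s - Module.finrank ℝ E) ∂μ := by
  let K (h : E) : ℝ≥0∞ := ‖h‖ₑ ^ (-s - Module.finrank ℝ E)
  have hK : Measurable K := by fun_prop
  let F (x : E) (p : ℝ × E) : ℝ≥0∞ := (uIoc (u x) (u (x + p.2))).indicator (fun _ => K p.2) p.1
  have hF : Measurable (Function.uncurry F) :=
    (show Measurable fun q : E × ℝ × E => K q.2.2 by fun_prop).indicator
      (measurableSet_mem_uIoc (f := fun q : E × ℝ × E => q.2.1) (a := fun q => u q.1)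
        (b := fun q => u (q.1 + q.2.2)) (by fun_prop) (by fun_prop) (by fun_prop))
  have hlayer : differenceIntegral μ s u = fun x => ∫⁻ p, F x p ∂volume.prod μ := by
    funext x
    rw [lintegral_prod_symm' (F x) (hF.comp measurable_prodMk_left)]
    exact lintegral_congr fun h => (lintegral_indicator_uIoc_const _ _ _).symm
  have hshift (p : ℝ × E) : ∫⁻ x, F x p ∂μ = levelShift μ u p.1 p.2 * K p.2 := by
    refine (lintegral_indicator_const ?_ (K p.2)).trans (mul_comm _ _)
    exact measurableSet_mem_uIoc measurable_const hu (by fun_prop)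
  rw [hlayer]
  refine (setLIntegral_rearrangement_lintegral_le hF (B := fun p => K p.2) (by fun_prop)
    (fun x p => indicator_le_self _ _ _) t).trans_eq ?_
  have hψ := measurable_levelShift μ hu
  simp only [hshift, ← (mul_left_mono (a := K _)).map_min]
  exact lintegral_prod _ (by fun_prop)

theorem lintegral_min_levelShift_mul_enorm_rpow_le [Nontrivial E] {s : ℝ} (hs₀ : 0 < s)
    (hs₁ : s < 1) {u : E → ℝ} (hu : Measurable u) (τ t : ℝ) :
    ∫⁻ h, min (ENNReal.ofReal t) (levelShift μ u τ h) * ‖h‖ₑ ^ (-s - Module.finrank ℝ E) ∂μ ≤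
      μ.toSphere univ * (((ENNReal.ofReal (1 - s))⁻¹ + (ENNReal.ofReal s)⁻¹) *
        (levelVariation μ u τ ^ s *
          (2 * min (ENNReal.ofReal t) (levelMeasure μ u τ)) ^ (1 - s))) := by
  have h := lintegral_min_mul_enorm_rpow_le μ hs₀ hs₁ (levelVariation μ u τ)
    (2 * min (ENNReal.ofReal t) (levelMeasure μ u τ))
  simp only [div_one, ENNReal.rpow_one] at h
  refine le_trans (lintegral_mono fun k => ?_) h
  gcongr ?_ * _
  refine le_min ((min_le_right _ _).trans (levelShift_le_levelVariation_mul_enorm μ hu τ k)) ?_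
  rw [(mul_right_mono (a := (2 : ℝ≥0∞))).map_min]
  exact min_le_min (le_mul_of_one_le_left' one_le_two) (levelShift_le_two_mul_levelMeasure μ τ k)

theorem exists_setLIntegral_rearrangement_differenceIntegral_le [Nontrivial E] {s : ℝ}
    (hs₀ : 0 < s) (hs₁ : s < 1) :
    ∃ C ≠ ∞, ∀ u : E → ℝ, Measurable u → ∀ t,
      ∫⁻ r in Ioc 0 t, rearrangement μ (differenceIntegral μ s u) r ≤
        C * ∫⁻ τ, levelVariation μ u τ ^ s *
          min (ENNReal.ofReal t ^ (1 - s)) (levelMeasure μ u τ ^ (1 - s)) := by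
  have hs : 0 < 1 - s := sub_pos.2 hs₁
  set c := μ.toSphere univ * ((ENNReal.ofReal (1 - s))⁻¹ + (ENNReal.ofReal s)⁻¹)
  have hc : c ≠ ∞ := by finiteness
  refine ⟨c * 2 ^ (1 - s), by finiteness, fun u hu t => ?_⟩
  rw [← lintegral_const_mul' _ _ (by finiteness)]
  refine (setLIntegral_rearrangement_differenceIntegral_le μ s hu t).trans
    (lintegral_mono fun τ => ?_)
  refine (lintegral_min_levelShift_mul_enorm_rpow_le μ hs₀ hs₁ hu τ t).trans_eq ?_
  rw [ENNReal.mul_rpow_of_nonneg _ _ hs.le, (ENNReal.monotone_rpow_of_nonneg hs.le).map_min]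
  ring

theorem exists_setLIntegral_rpow_mul_rearrangement_differenceIntegral_le [Nontrivial E] {s b : ℝ}
    (hs₀ : 0 < s) (hb : 0 < b) (hbs : b < 1 - s) :
    ∃ C ≠ ∞, ∀ u : E → ℝ, Measurable u →
      ∫⁻ t in Ioi (0 : ℝ), ENNReal.ofReal t ^ (-b - 1) *
          ∫⁻ r in Ioc 0 t, rearrangement μ (differenceIntegral μ s u) r ≤
        C * ∫⁻ τ, levelVariation μ u τ ^ s * levelMeasure μ u τ ^ (1 - s - b) := by
  have hs : 0 < 1 - s := hb.trans hbs
  obtain ⟨C, hC, hle⟩ :=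
    exists_setLIntegral_rearrangement_differenceIntegral_le μ hs₀ (sub_pos.1 hs)
  set c := (ENNReal.ofReal (1 - s - b))⁻¹ + (ENNReal.ofReal b)⁻¹
  have hc : c ≠ ∞ := by have := sub_pos.2 hbs; finiteness
  refine ⟨C * c, by finiteness, fun u hu => ?_⟩
  have hP := measurable_levelVariation μ hu
  have hM := measurable_levelMeasure μ hu
  set P := levelVariation μ u
  set M := levelMeasure μ u
  let w (t : ℝ) : ℝ≥0∞ := ENNReal.ofReal t ^ (-b - 1)
  let m (t τ : ℝ) : ℝ≥0∞ := min (ENNReal.ofReal t ^ (1 - s)) (M τ ^ (1 - s))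
  have hlevel (τ : ℝ) : ∫⁻ t in Ioi (0 : ℝ), w t * m t τ ≤ c * M τ ^ (1 - s - b) := by
    have h := lintegral_rpow_mul_min_le hb hbs 1 (M τ ^ (1 - s))
    simpa only [one_mul, ENNReal.one_rpow, ← ENNReal.rpow_mul, mul_sub, mul_one,
      mul_div_cancel₀ _ hs.ne'] using h
  calc ∫⁻ t in Ioi (0 : ℝ), w t * ∫⁻ r in Ioc 0 t, rearrangement μ (differenceIntegral μ s u) r
      ≤ ∫⁻ t in Ioi (0 : ℝ), w t * (C * ∫⁻ τ, P τ ^ s * m t τ) := by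
        gcongr with t
        exact hle u hu t
    _ = C * ∫⁻ t in Ioi (0 : ℝ), ∫⁻ τ, P τ ^ s * (w t * m t τ) := by
        rw [← lintegral_const_mul' _ _ hC]
        refine lintegral_congr fun t => ?_
        rw [mul_left_comm, ← lintegral_const_mul _ (by fun_prop)]
        simp only [mul_left_comm (w t)]
    _ = C * ∫⁻ τ, P τ ^ s * ∫⁻ t in Ioi (0 : ℝ), w t * m t τ := by
        rw [lintegral_lintegral_swap (by fun_prop)]
        congr! with τ
        exact lintegral_const_mul _ (by fun_prop)
    _ ≤ C * ∫⁻ τ, P τ ^ s * (c * M τ ^ (1 - s - b)) := by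
        gcongr with τ
        exact hlevel τ
    _ = C * c * ∫⁻ τ, P τ ^ s * M τ ^ (1 - s - b) := by
        simp only [mul_left_comm _ c]
        rw [lintegral_const_mul' _ _ hc, mul_assoc]

theorem exists_lintegral_levelVariation_rpow_mul_levelMeasure_rpow_le {α q : ℝ} (hα₀ : 0 < α)
    (hα₁ : α < 1) (hq : 0 < q) :
    ∃ C ≠ ∞, ∀ u : E → ℝ, Measurable u → ∀ V : ℝ≥0∞,
      (∀ h, ∫⁻ x, ‖u (x + h) - u x‖ₑ ∂μ ≤ ‖h‖ₑ * V) →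
      ∫⁻ τ, levelVariation μ u τ ^ (1 - α) * levelMeasure μ u τ ^ (1 / q * α) ≤
        C * V ^ (1 - α) * (lorentzNorm μ q 1 fun x => ‖u x‖ₑ) ^ α := by
  have hα : 0 < 1 - α := sub_pos.2 hα₁
  set a : ℝ≥0∞ := 2 ^ (Module.finrank ℝ E + 2)
  set c := 2 * ENNReal.ofReal (1 / q)
  refine ⟨a ^ (1 - α) * c ^ α, by finiteness, fun u hu V hV => ?_⟩
  have hP := measurable_levelVariation μ hu
  have hM := measurable_levelMeasure μ hu
  calc ∫⁻ τ, levelVariation μ u τ ^ (1 - α) * levelMeasure μ u τ ^ (1 / q * α)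
      ≤ (∫⁻ τ, levelVariation μ u τ) ^ (1 - α) *
          (∫⁻ τ, levelMeasure μ u τ ^ (1 / q)) ^ α := by
        simp only [ENNReal.rpow_mul]
        exact ENNReal.lintegral_mul_norm_pow_le hP.aemeasurable (by fun_prop) hα.le hα₀.le (by ring)
    _ ≤ (a * V) ^ (1 - α) * (c * lorentzNorm μ q 1 fun x => ‖u x‖ₑ) ^ α := by
        gcongr
        · exact lintegral_levelVariation_le μ hu hV
        · rw [mul_assoc]
          exact lintegral_levelMeasure_rpow_le μ u hq
    _ = _ := by
        rw [ENNReal.mul_rpow_of_nonneg _ _ hα.le, ENNReal.mul_rpow_of_nonneg _ _ hα₀.le]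
        ring

theorem exists_lorentzNorm_differenceIntegral_le (hn : 2 ≤ Module.finrank ℝ E) {α : ℝ}
    (hα₀ : 0 < α) (hα₁ : α < 1) :
    ∃ C ≠ ∞, ∀ u : E → ℝ, Measurable u → ∀ V : ℝ≥0∞,
      (∀ h, ∫⁻ x, ‖u (x + h) - u x‖ₑ ∂μ ≤ ‖h‖ₑ * V) →
      lorentzNorm μ (Module.finrank ℝ E / (Module.finrank ℝ E - α)) 1
          (differenceIntegral μ (1 - α) u) ≤
        C * V ^ (1 - α) *
          lorentzNorm μ (Module.finrank ℝ E / (Module.finrank ℝ E - 1)) 1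
            (fun x => ‖u x‖ₑ) ^ α := by
  have : Nontrivial E := Module.nontrivial_of_finrank_pos (R := ℝ) (by lia)
  set n : ℝ := (Module.finrank ℝ E : ℝ)
  have hn : 2 ≤ n := Nat.ofNat_le_cast.2 hn
  have hbα : α / n < α := div_lt_self hα₀ (by linarith)
  obtain ⟨C₁, hC₁, h₁⟩ := exists_setLIntegral_rpow_mul_rearrangement_differenceIntegral_le μ
    (s := 1 - α) (b := α / n) (by linarith) (by positivity) (by linarith)
  obtain ⟨C₂, hC₂, h₂⟩ := exists_lintegral_levelVariation_rpow_mul_levelMeasure_rpow_le μ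
    (q := n / (n - 1)) hα₀ hα₁ (div_pos (by linarith) (by linarith))
  refine ⟨C₁ * C₂, by finiteness, fun u hu V hV => ?_⟩
  have hweight : 1 / (n / (n - α)) - 1 - 1 = -(α / n) - 1 := by
    rw [one_div_div]
    field
  have hpower : 1 - (1 - α) - α / n = 1 / (n / (n - 1)) * α := by
    rw [one_div_div]
    field
  rw [lorentzNorm_one_eq, hweight, mul_assoc C₁, mul_assoc C₁]
  refine (h₁ u hu).trans ?_
  rw [hpower]
  gcongr
  exact h₂ u hu V hV

end DifferenceIntegral

section Representative

variable {d : ℕ} {u v : EuclideanSpace ℝ (Fin d) → ℝ}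

theorem totalVariation_congr_ae (h : u =ᵐ[volume] v) : totalVariation u = totalVariation v := by
  have hint (Φ : EuclideanSpace ℝ (Fin d) → EuclideanSpace ℝ (Fin d)) :
      ∫ x, u x * divergence Φ x = ∫ x, v x * divergence Φ x :=
    integral_congr_ae (h.mono fun x hx => congrArg (· * divergence Φ x) hx)
  simp only [totalVariation, hint]

theorem fracD_eq_differenceIntegral (s : ℝ) (u : EuclideanSpace ℝ (Fin d) → ℝ) :
    fracD s u = differenceIntegral volume s u := by
  funext x
  rw [fracD, differenceIntegral, ← lintegral_add_left_eq_self _ x]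
  refine lintegral_congr fun h => ?_
  rw [sub_add_cancel_left, enorm_neg, enorm_sub_rev, div_eq_mul_inv, ← ENNReal.rpow_neg,
    finrank_euclideanSpace_fin, neg_add']
  congr 2
  ring

theorem fracD_congr_ae (s : ℝ) (h : u =ᵐ[volume] v) : fracD s u =ᵐ[volume] fracD s v := by
  filter_upwards [h] with x hx
  refine lintegral_congr_ae ?_
  filter_upwards [h] with y hy
  rw [hx, hy]

end Representative

end LorentzBV

open LorentzBV in
theorem theorem4p1_general (d : ℕ) (hd : 2 ≤ d) (α : ℝ) (hα₀ : 0 < α) (hα₁ : α < 1) :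
    ∃ C : ℝ, 0 < C ∧ ∀ u : EuclideanSpace ℝ (Fin d) → ℝ, LocallyIntegrable u →
      lorentzNorm volume ((d : ℝ) / ((d : ℝ) - α)) 1 (fracD (1 - α) u) ≤
        ENNReal.ofReal C * totalVariation u ^ (1 - α) *
          lorentzNorm volume ((d : ℝ) / ((d : ℝ) - 1)) 1 (fun x => ‖u x‖ₑ) ^ α := by
  obtain ⟨C, hC, hbound⟩ := exists_lorentzNorm_differenceIntegral_le
    (volume : Measure (EuclideanSpace ℝ (Fin d))) (by rwa [finrank_euclideanSpace_fin]) hα₀ hα₁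
  refine ⟨C.toReal + 1, by positivity, fun u hu => ?_⟩
  have hC_le : C ≤ ENNReal.ofReal (C.toReal + 1) :=
    (ENNReal.le_ofReal_iff_toReal_le hC (by positivity)).2 (by linarith)
  obtain ⟨v, hv, huv⟩ := hu.aestronglyMeasurable.aemeasurable
  have hvu : LocallyIntegrable v := hu.congr huv
  have hnorm : (fun x => ‖u x‖ₑ) =ᵐ[volume] fun x => ‖v x‖ₑ := huv.fun_comp _
  rw [lorentzNorm_congr_ae (fracD_congr_ae (1 - α) huv), fracD_eq_differenceIntegral,
    totalVariation_congr_ae huv, lorentzNorm_congr_ae hnorm]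
  simp only [finrank_euclideanSpace_fin] at hbound
  refine (hbound v hv _ (lintegral_enorm_translate_sub_le hvu)).trans ?_
  gcongr

theorem theorem4p1 (d : ℕ) (hd : 2 ≤ d) (α : ℝ) (hα₀ : 0 < α) (hα₁ : α < 1) :
    ∃ C : ℝ, 0 < C ∧ ∀ u : EuclideanSpace ℝ (Fin d) → ℝ, LorentzBV.IsBV u →
      LorentzBV.lorentzNorm volume ((d : ℝ) / ((d : ℝ) - α)) 1 (LorentzBV.fracD (1 - α) u) ≤
        ENNReal.ofReal C * LorentzBV.totalVariation u ^ (1 - α) *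
          LorentzBV.lorentzNorm volume ((d : ℝ) / ((d : ℝ) - 1)) 1 (fun x => ‖u x‖ₑ) ^ α := by
  obtain ⟨C, hC, h⟩ := theorem4p1_general d hd α hα₀ hα₁
  exact ⟨C, hC, fun u hu => h u hu.1.locallyIntegrable⟩
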